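/- Fix integers $d\ge 1$, $n\ge 1$ and $1<p<\infty$, $p'=p/(p-1)$. Cubes in $\mathbb R^d$ have sides parallel to the axes, $m_J$ denotes the average over $J$, $|\cdot|$ the Euclidean norm on $\mathbb C^n$ and $\|\cdot\|$ the operator norm of an $n\times n$ complex matrix. A matrix weight is a measurable function $W:\mathbb R^d\to M_{n\times n}(\mathbb C)$ that is positive definite a.e.; it is a matrix $A_p$ weight if $$\sup_{I\text{ cube}}\frac1{|I|}\int_I\Big(\frac1{|I|}\int_I\|W^{1/p}(x)W^{-1/p}(t)\|^{p'}\,dt\Big)^{p/p'}dx<\infty ,$$ and $\|\vec f\|_{L^p(W)}=\big(\int_{\mathbb R^d}|W^{1/p}(x)\vec f(x)|^p\,dx\big)^{1/p}$ for $\vec f:\mathbb R^d\to\mathbb C^n$. Reducing operators for $U$ are matrices $V_I(U)$, one for each cube $I$ under consideration, such that $|V_I(U)\vec e|\approx\big(\frac1{|I|}\int_I|U^{1/p}(x)\vec e|^p\,dx\big)^{1/p}$ for all $\vec e\in\mathbb C^n$, with constants independent of $I$ and $\vec e$. **Theorem.** Let $K:\mathbb R^d\setminus\{0\}\to\mathbb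 C$ be not identically zero, homogeneous of degree $-d$ (that is, $K(tx)=t^{-d}K(x)$ for $t>0$), with mean zero over the unit sphere, and $C^\infty$ on the unit sphere. Let $T$ be the associated convolution operator, acting componentwise, $$T\vec f(x)=\lim_{\varepsilon\to0^+}\int_{|x-y|>\varepsilon}K(x-y)\vec f(y)\,dy .$$ Let $U,W$ be $n\times n$ matrix $A_p$ weights and let $B:\mathbb R^d\to M_{n\times n}(\mathbb C)$ be locally integrable. Suppose that $[T,B]\vec f=T(B\vec f)-B\,T\vec f$ is bounded from $L^p(U)$ to $L^p(W)$, i.e. there is $C<\infty$ with $\|[T,B]\vec f\|_{L^p(W)}\le C\|\vec f\|_{L^p(U)}$ for all bounded $\vec f$ with compact support. Then, for every choice of reducing operators $V_J(U)$, $$\sup_{J}\frac1{|J|}\int_J\big\|W^{1/p}(x)\,(B(x)-m_JB)\,V_J(U)^{-1}\big\|^p\,dx<\infty ,$$ where the supremum is over all cubes $J\subset\mathbb R^d$; likewise, for every dyadic grid $\mathcal D$, the supremum over $J\in\mathcal D$ is finite for every choice of reducing operators over $\mathcal D$. The hypotheses on $K$ hold for each of the Riesz kernels $K_j(x)=c_d\,x_j/|x|^{d+1}$,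 $1\le j\le d$, where $c_d=\Gamma(\frac{d+1}2)\,\pi^{-(d+1)/2}$. -/

import Mathlib

namespace TwoWeight

open MeasureTheory Filter Topology
open scoped ENNReal NNReal ContDiff ComplexOrder

noncomputable section

/-- The Euclidean space `ℝ^d`. -/
abbrev Eu (d : ℕ) : Type := EuclideanSpace ℝ (Fin d)

/-- The Hermitian space `ℂ^n`. -/
abbrev Cv (n : ℕ) : Type := EuclideanSpace ℂ (Fin n)

/-- Complex `n × n` matrices. -/
abbrev Mat (n : ℕ) : Type := Matrix (Fin n) (Fin n) ℂ

/-- The real power `A ^ s` of a positive definite matrix, through the spectral theorem: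
the functional calculus applied to `t ↦ t ^ s`. -/
def matPow {n : ℕ} (A : Mat n) (s : ℝ) : Mat n := cfc (fun t : ℝ => t ^ s) A

/-- The action of a matrix on a vector of `ℂ^n`. -/
def act {n : ℕ} (A : Mat n) (v : Cv n) : Cv n := Matrix.toEuclideanCLM (𝕜 := ℂ) A v

-- From here on `‖A‖` is the operator norm of a matrix `A` acting on `ℂ^n`.
open scoped Matrix.Norms.L2Operator

/-! ### Cubes and dyadic grids -/

/-- The half-open axis-parallel cube with lower corner `a` and side length `r`. -/
def cube {d : ℕ} (a : Eu d) (r : ℝ) : Set (Eu d) := {x | ∀ i, a i ≤ x i ∧ x i < a i + r}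

/-- The collection of all cubes of `ℝ^d`. -/
def allCubes (d : ℕ) : Set (Set (Eu d)) := {I | ∃ (a : Eu d) (r : ℝ), 0 < r ∧ I = cube a r}

/-- A dyadic grid: a collection of cubes with side lengths `2 ^ k`, `k ∈ ℤ`, such that the cubes
of each generation cover the space and any two cubes of the collection are nested or disjoint. -/
structure IsDyadicGrid {d : ℕ} (𝒟 : Set (Set (Eu d))) : Prop where
  isCube : ∀ I ∈ 𝒟, ∃ (a : Eu d) (k : ℤ), I = cube a ((2 : ℝ) ^ k)
  covers : ∀ (k : ℤ) (x : Eu d), ∃ a : Eu d, cube a ((2 : ℝ) ^ k) ∈ 𝒟 ∧ x ∈ cube a ((2 : ℝ) ^ k)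
  nested : ∀ I ∈ 𝒟, ∀ J ∈ 𝒟, I ⊆ J ∨ J ⊆ I ∨ Disjoint I J

/-! ### Matrix weights -/

/-- A matrix weight: a measurable matrix function that is positive definite almost everywhere. -/
structure IsMatrixWeight {d n : ℕ} (W : Eu d → Mat n) : Prop where
  aestronglyMeasurable : AEStronglyMeasurable W volume
  posDef : ∀ᵐ x, (W x).PosDef

/-- The matrix `A_p` characteristic. -/
def apConst {d n : ℕ} (p : ℝ) (W : Eu d → Mat n) : ℝ≥0∞ :=
  ⨆ I ∈ allCubes d, ⨍⁻ x in I,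
    (⨍⁻ t in I, ‖matPow (W x) (1 / p) * matPow (W t) (-(1 / p))‖ₑ ^ (Real.conjExponent p) ∂volume)
      ^ (p / Real.conjExponent p) ∂volume

/-- A matrix `A_p` weight. -/
structure IsMatrixAp {d n : ℕ} (p : ℝ) (W : Eu d → Mat n) : Prop extends IsMatrixWeight W where
  apConst_lt_top : apConst p W < ⊤

/-- The norm of `L^p(W)`, with values in `[0, ∞]`. -/
def weightedNorm {d n : ℕ} (p : ℝ) (W : Eu d → Mat n) (f : Eu d → Cv n) : ℝ≥0∞ :=
  (∫⁻ x, ‖act (matPow (W x) (1 / p)) (f x)‖ₑ ^ p) ^ (1 / p)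

/-- `V` is a family of reducing operators for `W` over the collection `𝒬` of cubes: with constants
that do not depend on the cube `I ∈ 𝒬` or on the vector `e`,
`|I|^(-1/p) ‖1_I W^(1/p) e‖_(L^p) ≈ |V_I e|`. -/
def IsReducing {d n : ℕ} (p : ℝ) (W : Eu d → Mat n) (𝒬 : Set (Set (Eu d)))
    (V : Set (Eu d) → Mat n) : Prop :=
  ∃ c C : ℝ≥0, 0 < c ∧ ∀ I ∈ 𝒬, ∀ e : Cv n,
    c * ‖act (V I) e‖ₑ ≤ (⨍⁻ x in I, ‖act (matPow (W x) (1 / p)) e‖ₑ ^ p ∂volume) ^ (1 / p) ∧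
    (⨍⁻ x in I, ‖act (matPow (W x) (1 / p)) e‖ₑ ^ p ∂volume) ^ (1 / p) ≤ C * ‖act (V I) e‖ₑ

/-- The two weight BMO condition over a collection `𝒬` of cubes: for every choice of reducing
operators `V_J = V_J(U)`,
`sup_(J ∈ 𝒬) |J|⁻¹ ∫_J ‖W^(1/p)(x) (B(x) - m_J B) V_J⁻¹‖^p dx < ∞`. -/
def TwoWeightBMO {d n : ℕ} (p : ℝ) (W U : Eu d → Mat n) (𝒬 : Set (Set (Eu d)))
    (B : Eu d → Mat n) : Prop :=
  ∀ V : Set (Eu d) → Mat n, IsReducing p U 𝒬 V →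
    (⨆ J ∈ 𝒬, ⨍⁻ x in J, ‖matPow (W x) (1 / p) * (B x - ⨍ y in J, B y) * (V J)⁻¹‖ₑ ^ p ∂volume) < ⊤

/-! ### Convolution Calderón-Zygmund operators and commutators -/

/-- A kernel `K` on `ℝ^d ∖ {0}` (its value at `0` plays no role) that is not identically zero, is
homogeneous of degree `-d`, has mean zero over the unit sphere (with respect to surface measure)
and is smooth on the unit sphere. -/
structure IsHomogeneousKernel {d : ℕ} (K : Eu d → ℂ) : Prop where
  ne_zero : ∃ x, x ≠ 0 ∧ K x ≠ 0
  homogeneous : ∀ t : ℝ, 0 < t → ∀ x, x ≠ 0 → K (t • x) = (t ^ d)⁻¹ • K x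
  mean_zero : ∫ θ : Metric.sphere (0 : Eu d) 1, K θ ∂(volume : Measure (Eu d)).toSphere = 0
  smooth : ContDiffOn ℝ ∞ K (Metric.sphere (0 : Eu d) 1)

/-- The kernel `c_d x_j / |x|^(d + 1)` of the `j`-th Riesz transform,
`c_d = Γ((d + 1) / 2) / π^((d + 1) / 2)`. -/
def rieszKernel {d : ℕ} (j : Fin d) (x : Eu d) : ℂ :=
  ((Real.Gamma ((d + 1) / 2) / Real.pi ^ (((d : ℝ) + 1) / 2) * (x j / ‖x‖ ^ (d + 1)) : ℝ) : ℂ)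

/-- The truncated operator `∫_(|x - y| > ε) K(x - y) f(y) dy`. -/
def truncated {d n : ℕ} (K : Eu d → ℂ) (ε : ℝ) (f : Eu d → Cv n) (x : Eu d) : Cv n :=
  ∫ y in {y | ε < ‖x - y‖}, K (x - y) • f y

/-- The convolution operator with kernel `K`, as a principal value. -/
def czo {d n : ℕ} (K : Eu d → ℂ) (f : Eu d → Cv n) (x : Eu d) : Cv n :=
  limUnder (𝓝[>] (0 : ℝ)) (fun ε => truncated K ε f x)

/-- The commutator `[T, B] f = T (B f) - B (T f)`, where `T` is the convolution operator with
kernel `K`, acting componentwise. -/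
def czoCommutator {d n : ℕ} (K : Eu d → ℂ) (B : Eu d → Mat n) (f : Eu d → Cv n) (x : Eu d) : Cv n :=
  czo K (fun y => act (B y) (f y)) x - act (B x) (czo K f x)

/-- `[T, B]` is bounded from `L^p(U)` to `L^p(W)`: it satisfies the norm inequality on the bounded
functions with compact support. This is the class on which `[T, B]` is defined for every locally
integrable `B`, since `B f` is then integrable; it is dense in `L^p(U)` if `U` is an `A_p` weight. -/
def CommutatorBounded {d n : ℕ} (p : ℝ) (K : Eu d → ℂ) (B U W : Eu d → Mat n) : Prop :=
  ∃ C : ℝ≥0, ∀ f : Eu d → Cv n, MemLp f ⊤ volume → HasCompactSupport f →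
    weightedNorm p W (czoCommutator K B f) ≤ C * weightedNorm p U f

end

end TwoWeight

namespace TwoWeight

open MeasureTheory Filter Topology
open scoped ENNReal NNReal ContDiff ComplexOrder
open scoped Matrix.Norms.L2Operator

/-! ### Powers of positive definite matrices -/

section Matrix

variable {n : ℕ}

/-! Near some `z₀ ≠ 0` the kernel does not vanish, so there `1 / K` agrees with a Schwartz function
`φ`, which is a superposition of characters with an integrable density `ψ`. Given a cube `J`,
translate it to a cube `J'` so far away, relative to its side, that a fixed rescaling `lam • (x -
y)` stays near `z₀` for `x ∈ J`, `y ∈ J'`. By homogeneity `K (x - y) * φ (lam • (x - y))` is then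
the constant `lam ^ d`. Hence `lam ^ d |J'| (B x - m_{J'} B) e` is, up to sign, the integral of `K
(x - y) φ (lam • (x - y)) (B y - B x) e` over `J'`; expanding `φ` makes it an average against `ψ ξ`,
up to unimodular factors, of commutators applied to `1_{J'}` times a character times `e`.

Characters do not change the norm in `L^p(U)`, so Jensen and boundedness of the commutator give a
scale-invariant bound for the oscillation around `m_{J'} B` (`exists_lintegral_oscillation_le`).

The `A_p` conditions bring everything back to `J`: doubling of `U` compares `J'` with `J`
(`doubling_lintegral_act`), the columns of `V_J⁻¹` serve as test vectors, and boundedness of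
averaging on `L^p(W)` replaces `m_{J'} B` by `m_J B` (`lintegral_enorm_mul_average_le`). -/

theorem spectrum_subset_Ioi_of_posDef {A : Mat n} (hA : A.PosDef) :
    spectrum ℝ A ⊆ Set.Ioi 0 := by
  intro t ht
  rw [hA.isHermitian.spectrum_real_eq_range_eigenvalues] at ht
  obtain ⟨i, rfl⟩ := ht
  exact hA.eigenvalues_pos i

theorem continuousOn_rpow_Ioi (s : ℝ) : ContinuousOn (fun t : ℝ => t ^ s) (Set.Ioi 0) :=
  fun _ ht => (Real.continuousAt_rpow_const _ _ (Or.inl (ne_of_gt ht))).continuousWithinAt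

theorem matPow_neg_mul_matPow {A : Mat n} (hA : A.PosDef) (s : ℝ) :
    matPow A (-s) * matPow A s = 1 := by
  have hsp := spectrum_subset_Ioi_of_posDef hA
  have hsa : IsSelfAdjoint A := hA.isHermitian
  unfold matPow
  rw [← cfc_mul (fun t : ℝ => t ^ (-s)) (fun t : ℝ => t ^ s) A
    ((continuousOn_rpow_Ioi _).mono hsp) ((continuousOn_rpow_Ioi _).mono hsp),
    ← cfc_one ℝ A]
  refine cfc_congr fun t ht => ?_
  have ht0 : 0 < t := hsp ht
  simp [← Real.rpow_add ht0]

theorem continuousOn_matPow (s : ℝ) :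
    ContinuousOn (fun A : Mat n => matPow A s) {A | A.PosDef} := by
  unfold matPow
  refine ContinuousOn.cfc_of_mem_nhdsSet (s := Set.Ioi (0 : ℝ)) (a := fun A : Mat n => A) _
    ?_ continuousOn_id (fun A hA => hA.isHermitian) (continuousOn_rpow_Ioi s)
  exact isOpen_Ioi.mem_nhdsSet.2 (Set.iUnion₂_subset fun A hA => spectrum_subset_Ioi_of_posDef hA)

theorem isClosed_posSemidef : IsClosed {A : Mat n | A.PosSemidef} := by
  simp only [Matrix.posSemidef_iff_dotProduct_mulVec, Set.ofPred_and, Set.ofPred_forall]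
  refine IsClosed.inter ?_ (isClosed_iInter fun v => ?_)
  · exact isClosed_eq (by fun_prop) continuous_id
  · exact isClosed_le continuous_const (by fun_prop)

/-- The power is continuous on the positive definite matrices, a Borel set (closed semidefinite cone
minus the zeros of the determinant), so its extension by zero is Borel and agrees with it along `W`
almost everywhere. -/
theorem aestronglyMeasurable_matPow {α : Type*} [MeasurableSpace α] {μ : Measure α}
    {W : α → Mat n} (hW : AEStronglyMeasurable W μ) (hpos : ∀ᵐ x ∂μ, (W x).PosDef) (s : ℝ) :
    AEStronglyMeasurable (fun x => matPow (W x) s) μ := by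
  let _ : MeasurableSpace (Mat n) := borel _
  have : BorelSpace (Mat n) := ⟨rfl⟩
  have hP : MeasurableSet {A : Mat n | A.PosDef} := by
    have : {A : Mat n | A.PosDef} = {A | A.PosSemidef} ∩ {A | A.det ≠ 0} := by
      ext A
      constructor
      · exact fun hA => ⟨hA.posSemidef, hA.det_pos.ne'⟩
      · exact fun hA => hA.1.posDef_iff_isUnit.2
          ((Matrix.isUnit_iff_isUnit_det A).2 (isUnit_iff_ne_zero.2 hA.2))
    rw [this]
    exact isClosed_posSemidef.measurableSet.inter
      (isOpen_ne_fun (by fun_prop) continuous_const).measurableSet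
  classical
  have hm : Measurable (Set.piecewise {A : Mat n | A.PosDef} (fun A => matPow A s) (fun _ => 0)) :=
    (continuousOn_matPow s).measurable_piecewise continuousOn_const hP
  have : SecondCountableTopology (Mat n) := inferInstanceAs (SecondCountableTopology (Fin n → Fin n → ℂ))
  have h := (hm.comp_aemeasurable hW.aemeasurable).aestronglyMeasurable
  refine h.congr ?_
  filter_upwards [hpos] with x hx
  simp [Set.piecewise, hx]

theorem norm_act_le (A : Mat n) (v : Cv n) : ‖act A v‖ₑ ≤ ‖A‖ₑ * ‖v‖ₑ := by
  have := (Matrix.toEuclideanCLM (𝕜 := ℂ) A).le_opENorm v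
  exact this

theorem act_mul (A B : Mat n) (v : Cv n) : act (A * B) v = act A (act B v) := by
  simp [act]

theorem act_sub (A B : Mat n) (v : Cv n) : act (A - B) v = act A v - act B v := by
  simp [act]

theorem act_smul (A : Mat n) (c : ℂ) (v : Cv n) : act A (c • v) = c • act A v := by
  simp [act]

/-- Passes from estimates for single vectors `e`, which the commutator supplies, to estimates for
matrices. -/
theorem opNorm_le_sum_act_basis (A : Mat n) :
    ‖A‖ₑ ≤ ∑ i, ‖act A (EuclideanSpace.single i (1 : ℂ))‖ₑ := by
  have h : ‖A‖ ≤ ∑ i, ‖act A (EuclideanSpace.single i (1 : ℂ))‖ := by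
    refine ContinuousLinearMap.opNorm_le_bound (Matrix.toEuclideanCLM (𝕜 := ℂ) A)
      (Finset.sum_nonneg fun _ _ => norm_nonneg _) fun v => ?_
    have hv : v = ∑ i, v i • EuclideanSpace.single i (1 : ℂ) := by
      ext j
      simp [Pi.single_apply]
    have : Matrix.toEuclideanCLM (𝕜 := ℂ) A v =
        ∑ i, v i • act A (EuclideanSpace.single i (1 : ℂ)) := by
      conv_lhs => rw [hv]
      simp [map_sum, act, -Matrix.toEuclideanCLM_toLp]
    rw [this, Finset.sum_mul]
    refine (norm_sum_le _ _).trans (Finset.sum_le_sum fun i _ => ?_)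
    rw [norm_smul, mul_comm]
    gcongr
    exact PiLp.norm_apply_le v i
  rw [← ofReal_norm, ← ENNReal.ofReal_toReal (a := ∑ i, _)]
  · refine ENNReal.ofReal_le_ofReal (h.trans_eq ?_)
    rw [ENNReal.toReal_sum (by simp)]
    simp
  · simp

/-- The action of matrices on vectors as a continuous bilinear map. -/
noncomputable def actL (n : ℕ) : Mat n →L[ℂ] Cv n →L[ℂ] Cv n :=
  LinearMap.toContinuousLinearMap
    { toFun := fun A => Matrix.toEuclideanCLM (𝕜 := ℂ) A
      map_add' := fun A B => map_add _ A B
      map_smul' := fun c A => map_smul _ c A }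

theorem continuous_act : Continuous fun q : Mat n × Cv n => act q.1 q.2 :=
  ((actL n).continuous.comp continuous_fst).clm_apply continuous_snd

theorem aestronglyMeasurable_act {α : Type*} [MeasurableSpace α]
    {μ : Measure α} {A : α → Mat n} {v : α → Cv n} (hA : AEStronglyMeasurable A μ)
    (hv : AEStronglyMeasurable v μ) : AEStronglyMeasurable (fun x => act (A x) (v x)) μ := by
  have hq : AEStronglyMeasurable (fun x => (A x, v x)) μ := hA.prodMk hv
  have h := continuous_act.comp_aestronglyMeasurable hq
  exact h

/-- A singular matrix has inverse `0` by convention, so the bound needs no invertibility. -/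
theorem enorm_mul_inv_le_one (A : Mat n) : ‖A * A⁻¹‖ₑ ≤ 1 := by
  by_cases h : IsUnit A.det
  · rw [Matrix.mul_nonsing_inv _ h]
    rw [← ofReal_norm, ENNReal.ofReal_le_one]
    refine ContinuousLinearMap.opNorm_le_bound (Matrix.toEuclideanCLM (𝕜 := ℂ) (1 : Mat n))
      zero_le_one fun v => ?_
    simp
  · rw [Matrix.nonsing_inv_apply_not_isUnit _ h]
    simp

end Matrix

/-! ### Cubes -/

section Cubes

variable {d : ℕ}

theorem cube_eq_preimage (a : Eu d) (r : ℝ) :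
    cube a r = (fun x : Eu d => (x : Fin d → ℝ)) ⁻¹' Set.univ.pi fun i => Set.Ico (a i) (a i + r) := by
  ext x
  simp [cube]

theorem measurableSet_cube (a : Eu d) (r : ℝ) : MeasurableSet (cube a r) := by
  rw [cube_eq_preimage]
  exact (PiLp.volume_preserving_ofLp (Fin d)).measurable
    (MeasurableSet.univ_pi fun _ => measurableSet_Ico)

theorem volume_cube (a : Eu d) (r : ℝ) : volume (cube a r) = ENNReal.ofReal r ^ d := by
  rw [cube_eq_preimage, (PiLp.volume_preserving_ofLp (Fin d)).measure_preimage
    (MeasurableSet.univ_pi fun _ => measurableSet_Ico).nullMeasurableSet, volume_pi_pi]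
  simp

theorem volume_cube_ne_top (a : Eu d) (r : ℝ) : volume (cube a r) ≠ ⊤ := by
  simp [volume_cube]

theorem volume_cube_ne_zero (a : Eu d) {r : ℝ} (hr : 0 < r) : volume (cube a r) ≠ 0 := by
  simp [volume_cube, hr]

theorem norm_sub_le_of_mem_cube {a : Eu d} {r : ℝ} {x y : Eu d}
    (hx : x ∈ cube a r) (hy : y ∈ cube a r) : ‖x - y‖ ≤ r * √d := by
  have h : ‖x - y‖ ^ 2 ≤ r ^ 2 * d := by
    rw [EuclideanSpace.norm_sq_eq]
    calc ∑ i, ‖(x - y) i‖ ^ 2 ≤ ∑ _i : Fin d, r ^ 2 := by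
          refine Finset.sum_le_sum fun i _ => ?_
          rw [Real.norm_eq_abs, sq_abs, sq_le_sq, PiLp.sub_apply]
          have := hx i
          have := hy i
          refine (abs_le.2 ⟨?_, ?_⟩ : |x i - y i| ≤ r).trans (le_abs_self r) <;> linarith
      _ = r ^ 2 * d := by simp [mul_comm]
  -- In dimension `0` membership in a cube does not force `0 ≤ r`.
  rcases Nat.eq_zero_or_pos d with rfl | hd
  · simp [Subsingleton.elim x y]
  have hr : 0 ≤ r := by
    have := hx ⟨0, hd⟩
    linarith
  calc ‖x - y‖ = √(‖x - y‖ ^ 2) := (Real.sqrt_sq (norm_nonneg _)).symm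
    _ ≤ √(r ^ 2 * d) := Real.sqrt_le_sqrt h
    _ = r * √d := by rw [Real.sqrt_mul (sq_nonneg r), Real.sqrt_sq hr]

theorem self_mem_cube (a : Eu d) {r : ℝ} (hr : 0 < r) : a ∈ cube a r :=
  fun i => ⟨le_rfl, by linarith⟩

theorem cube_subset_closedBall (a : Eu d) {r : ℝ} (hr : 0 < r) :
    cube a r ⊆ Metric.closedBall a (r * √d) := fun x hx => by
  rw [mem_closedBall_iff_norm]
  exact norm_sub_le_of_mem_cube hx (self_mem_cube a hr)

theorem add_mem_cube_iff {a v y : Eu d} {r : ℝ} : y + v ∈ cube (a + v) r ↔ y ∈ cube a r := by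
  simp [cube, add_right_comm]

/-- A cube and a translate of it lie in a common cube of comparable size. -/
theorem exists_common_cube (a v : Eu d) {r κ : ℝ} (hr : 0 < r) (hκ : 0 ≤ κ) (hv : ‖v‖ ≤ κ * r) :
    ∃ b : Eu d, cube a r ⊆ cube b ((2 * κ + 1) * r) ∧
      cube (a + v) r ⊆ cube b ((2 * κ + 1) * r) := by
  -- Each coordinate of `v` is at most `κ * r` in absolute value, so room `κ * r` on both sides
  -- suffices.
  refine ⟨a - WithLp.toLp 2 (fun _ => κ * r), fun x hx i => ?_, fun x hx i => ?_⟩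
  · have := hx i
    have : 0 ≤ κ * r := by positivity
    simp only [PiLp.sub_apply]
    constructor <;> linarith
  · have h := hx i
    have hvi := abs_le.1 ((PiLp.norm_apply_le v i).trans hv)
    simp only [PiLp.sub_apply, PiLp.add_apply] at h ⊢
    constructor <;> linarith

theorem integrableOn_cube {E : Type*} [NormedAddCommGroup E] {f : Eu d → E}
    (hf : LocallyIntegrable f volume) (a : Eu d) {r : ℝ} (hr : 0 < r) :
    IntegrableOn f (cube a r) volume :=
  (hf.integrableOn_isCompact (isCompact_closedBall _ _)).mono_set (cube_subset_closedBall a hr)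

end Cubes

theorem locallyIntegrable_matrix {α : Type*} [MeasurableSpace α] [TopologicalSpace α]
    {μ : Measure α} {n : ℕ} {B : α → Mat n}
    (hB : ∀ i j, LocallyIntegrable (fun x => B x i j) μ) : LocallyIntegrable B μ := by
  have h : B = fun x => ∑ i, ∑ j, B x i j • Matrix.single i j (1 : ℂ) := by
    funext x
    conv_lhs => rw [Matrix.matrix_eq_sum_single (B x)]
    simp [Matrix.smul_single]
  rw [h]
  intro x
  choose s hs hi using fun i j => hB i j x
  refine ⟨⋂ i, ⋂ j, s i j, by simpa [Filter.iInter_mem] using hs, ?_⟩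
  refine integrable_finsetSum _ fun i _ => integrable_finsetSum _ fun j _ => ?_
  exact ((hi i j).mono_set ((Set.iInter_subset _ i).trans (Set.iInter_subset _ j))).smul_const _

/-! ### Inequalities for lower integrals -/

section LIntegral

variable {α : Type*} [MeasurableSpace α] {μ : Measure α}

theorem lintegral_mul_rpow_le {p : ℝ} (hp : 1 < p) {f g : α → ℝ≥0∞} (hf : AEMeasurable f μ)
    (hg : AEMeasurable g μ) :
    (∫⁻ x, f x * g x ∂μ) ^ p ≤
      (∫⁻ x, f x ^ p.conjExponent ∂μ) ^ (p / p.conjExponent) * ∫⁻ x, g x ^ p ∂μ := by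
  have hpq := Real.HolderConjugate.conjExponent hp
  have hp0 : 0 < p := by linarith
  have h := ENNReal.lintegral_mul_le_Lp_mul_Lq μ hpq.symm hf hg
  refine (ENNReal.rpow_le_rpow h hp0.le).trans_eq ?_
  rw [ENNReal.mul_rpow_of_nonneg _ _ hp0.le, ← ENNReal.rpow_mul, ← ENNReal.rpow_mul,
    one_div_mul_cancel hp0.ne', ENNReal.rpow_one]
  congr 2
  ring

/-- Jensen for the unnormalised measure `w dμ`, from Hölder with `w = w ^ (1/p') * w ^ (1/p)`. It is
applied with `w = ‖ψ‖ₑ`. -/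
theorem lintegral_weight_mul_rpow_le {p : ℝ} (hp : 1 < p) {w g : α → ℝ≥0∞} (hw : AEMeasurable w μ)
    (hg : AEMeasurable g μ) :
    (∫⁻ x, w x * g x ∂μ) ^ p ≤ (∫⁻ x, w x ∂μ) ^ (p - 1) * ∫⁻ x, w x * g x ^ p ∂μ := by
  have hpq := Real.HolderConjugate.conjExponent hp
  have hp0 : 0 < p := by linarith
  have hq0 := hpq.symm.pos
  have hsplit : ∀ x, w x * g x = w x ^ (1 / p.conjExponent) * (w x ^ (1 / p) * g x) := fun x => by
    rw [← mul_assoc, ← ENNReal.rpow_add_of_nonneg _ _ (by positivity) (by positivity), one_div,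
      one_div, hpq.symm.inv_add_inv_eq_one, ENNReal.rpow_one]
  have he : p / p.conjExponent = p - 1 := by
    rw [Real.conjExponent, div_div_eq_mul_div, mul_div_cancel_left₀ _ hp0.ne']
  have h := lintegral_mul_rpow_le hp (f := fun x => w x ^ (1 / p.conjExponent))
    (g := fun x => w x ^ (1 / p) * g x) (hw.pow_const _) ((hw.pow_const _).mul hg)
  simpa only [← hsplit, ENNReal.mul_rpow_of_nonneg _ _ hp0.le, ← ENNReal.rpow_mul,
    one_div_mul_cancel hp0.ne', one_div_mul_cancel hq0.ne', ENNReal.rpow_one, he] using h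

end LIntegral

/-! ### Consequences of the matrix `A_p` condition -/

section Ap

variable {d n : ℕ} {p : ℝ} {W : Eu d → Mat n}

theorem IsMatrixWeight.aestronglyMeasurable_matPow (hW : IsMatrixWeight W) (s : ℝ) :
    AEStronglyMeasurable (fun x => matPow (W x) s) volume :=
  TwoWeight.aestronglyMeasurable_matPow hW.aestronglyMeasurable hW.posDef s

theorem aemeasurable_enorm_act (hW : IsMatrixWeight W) (s : ℝ) (e : Cv n) :
    AEMeasurable (fun x => ‖act (matPow (W x) s) e‖ₑ) volume :=
  (aestronglyMeasurable_act (hW.aestronglyMeasurable_matPow s) aestronglyMeasurable_const).enorm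

theorem lintegral_eq_measure_mul_laverage {α : Type*} [MeasurableSpace α] {μ : Measure α}
    {s : Set α} (hs : μ s ≠ ⊤) (f : α → ℝ≥0∞) :
    ∫⁻ x in s, f x ∂μ = μ s * ⨍⁻ x in s, f x ∂μ :=
  (measure_mul_setLAverage f hs).symm

theorem lintegral_lintegral_le_apConst (hp : 1 < p) (W : Eu d → Mat n) (a : Eu d) {r : ℝ}
    (hr : 0 < r) :
    ∫⁻ x in cube a r, (∫⁻ t in cube a r,
        ‖matPow (W x) (1 / p) * matPow (W t) (-(1 / p))‖ₑ ^ p.conjExponent) ^ (p / p.conjExponent)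
      ≤ apConst p W * volume (cube a r) ^ p := by
  have hv := volume_cube_ne_top a r
  have hv0 := volume_cube_ne_zero a hr
  have hpq := Real.HolderConjugate.conjExponent hp
  have hp0 : 0 < p := by linarith
  have he : p / p.conjExponent = p - 1 := by
    rw [Real.conjExponent, div_div_eq_mul_div, mul_div_cancel_left₀ _ hp0.ne']
  have he0 : 0 ≤ p / p.conjExponent := by rw [he]; linarith
  have h1 : (⨍⁻ x in cube a r, (⨍⁻ t in cube a r,
      ‖matPow (W x) (1 / p) * matPow (W t) (-(1 / p))‖ₑ ^ p.conjExponent ∂volume)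
        ^ (p / p.conjExponent) ∂volume) ≤ apConst p W :=
    le_iSup₂_of_le (cube a r) ⟨a, r, hr, rfl⟩ le_rfl
  rw [lintegral_eq_measure_mul_laverage hv]
  simp_rw [lintegral_eq_measure_mul_laverage hv, ENNReal.mul_rpow_of_nonneg _ _ he0]
  rw [laverage, lintegral_const_mul' _ _ (ENNReal.rpow_ne_top_of_nonneg he0 hv), ← mul_assoc, mul_comm]
  -- The volume powers combine to `1 + p / p' = p`.
  refine mul_le_mul' h1 (le_of_eq ?_)
  nth_rewrite 1 [← ENNReal.rpow_one (volume (cube a r))]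
  rw [← ENNReal.rpow_add _ _ hv0 hv, he]
  ring_nf

/-- Hölder's inequality with the kernel `‖W(x)^{1/p} W(t)^{-1/p}‖` of the `A_p` condition. -/
theorem lintegral_rpow_lintegral_le (hp : 1 < p) (hW : IsMatrixWeight W) {J : Set (Eu d)} {b : Eu d}
    {r : ℝ} (hr : 0 < r) (hJ : J ⊆ cube b r) {g : Eu d → ℝ≥0∞}
    (hg : AEMeasurable g (volume.restrict J)) (hfin : ∫⁻ t in J, g t ^ p ≠ ⊤) :
    ∫⁻ x in cube b r, (∫⁻ t in J, ‖matPow (W x) (1 / p) * matPow (W t) (-(1 / p))‖ₑ * g t) ^ p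
      ≤ apConst p W * volume (cube b r) ^ p * ∫⁻ t in J, g t ^ p := by
  have hpq := Real.HolderConjugate.conjExponent hp
  have hp0 : 0 < p := by linarith
  have hmeas : ∀ x, AEMeasurable (fun t => ‖matPow (W x) (1 / p) * matPow (W t) (-(1 / p))‖ₑ)
      (volume.restrict J) := fun x => by
    have hc : Continuous fun A : Mat n => matPow (W x) (1 / p) * A := continuous_const_mul _
    exact (hc.comp_aestronglyMeasurable (hW.aestronglyMeasurable_matPow _)).enorm.restrict
  calc _ ≤ ∫⁻ x in cube b r, (∫⁻ t in J, ‖matPow (W x) (1 / p) * matPow (W t) (-(1 / p))‖ₑ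
          ^ p.conjExponent) ^ (p / p.conjExponent) * ∫⁻ t in J, g t ^ p :=
        lintegral_mono fun x => lintegral_mul_rpow_le hp (hmeas x) hg
    _ = (∫⁻ x in cube b r, (∫⁻ t in J, ‖matPow (W x) (1 / p) * matPow (W t) (-(1 / p))‖ₑ
          ^ p.conjExponent) ^ (p / p.conjExponent)) * ∫⁻ t in J, g t ^ p :=
        lintegral_mul_const' _ _ hfin
    _ ≤ (∫⁻ x in cube b r, (∫⁻ t in cube b r, ‖matPow (W x) (1 / p) * matPow (W t) (-(1 / p))‖ₑ
          ^ p.conjExponent) ^ (p / p.conjExponent)) * ∫⁻ t in J, g t ^ p := by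
        gcongr
        exact div_nonneg hp0.le hpq.symm.pos.le
    _ ≤ _ := by
        gcongr
        exact lintegral_lintegral_le_apConst hp W b hr

/-- Inserting `A ^ (-s) * A ^ s = 1` with `A = W t` and `D = W(x)^(1/p)` brings out the kernel of
the `A_p` condition. -/
theorem enorm_act_le_of_posDef {A D : Mat n} (hA : A.PosDef) (s : ℝ) (e : Cv n) :
    ‖act D e‖ₑ ≤ ‖D * matPow A (-s)‖ₑ * ‖act (matPow A s) e‖ₑ := by
  refine le_trans (le_of_eq ?_) (norm_act_le _ _)
  rw [← act_mul, mul_assoc, matPow_neg_mul_matPow hA, mul_one]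

theorem enorm_mul_le_of_posDef {A D : Mat n} (hA : A.PosDef) (s : ℝ) (F : Mat n) :
    ‖D * F‖ₑ ≤ ‖D * matPow A (-s)‖ₑ * ‖matPow A s * F‖ₑ := by
  have h : D * F = (D * matPow A (-s)) * (matPow A s * F) := by
    rw [mul_assoc, ← mul_assoc (matPow A (-s)), matPow_neg_mul_matPow hA, one_mul]
  rw [h]
  rw [enorm_eq_nnnorm, enorm_eq_nnnorm, enorm_eq_nnnorm]
  exact_mod_cast nnnorm_mul_le _ _

/-- The doubling property of `A_p` weights. -/
theorem doubling_lintegral_act (hp : 1 < p) (hW : IsMatrixWeight W) {J : Set (Eu d)} {b : Eu d}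
    {r : ℝ} (hr : 0 < r) (hJ : J ⊆ cube b r) (e : Cv n)
    (hfin : ∫⁻ t in J, ‖act (matPow (W t) (1 / p)) e‖ₑ ^ p ≠ ⊤) :
    volume J ^ p * ∫⁻ x in cube b r, ‖act (matPow (W x) (1 / p)) e‖ₑ ^ p
      ≤ apConst p W * volume (cube b r) ^ p * ∫⁻ t in J, ‖act (matPow (W t) (1 / p)) e‖ₑ ^ p := by
  have hp0 : 0 < p := by linarith
  have hJv : volume J ≠ ⊤ := measure_ne_top_of_subset hJ (volume_cube_ne_top b r)
  refine le_trans ?_ (lintegral_rpow_lintegral_le hp hW hr hJ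
    (aemeasurable_enorm_act hW (1 / p) e).restrict hfin)
  rw [← lintegral_const_mul' _ _ (ENNReal.rpow_ne_top_of_nonneg hp0.le hJv)]
  refine lintegral_mono fun x => ?_
  dsimp only
  rw [← ENNReal.mul_rpow_of_nonneg _ _ hp0.le]
  refine ENNReal.rpow_le_rpow ?_ hp0.le
  -- The left side does not depend on `t`: write `|J|` times it as an integral over `J` and compare
  -- pointwise.
  rw [mul_comm, ← setLIntegral_const]
  refine lintegral_mono_ae ?_
  filter_upwards [ae_restrict_of_ae hW.posDef] with t ht
  exact enorm_act_le_of_posDef ht _ _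

/-- Averaging over a cube is bounded on `L^p(W)` by the `A_p` constant: `W(x)^(1/p) m F` is the mean
over `t` of `W(x)^(1/p) W(t)^(-1/p)` applied to `W(t)^(1/p) F(t)`. -/
theorem lintegral_enorm_mul_average_le (hp : 1 < p) (hW : IsMatrixWeight W) (b : Eu d)
    {r : ℝ} (hr : 0 < r) {F : Eu d → Mat n} (hF : IntegrableOn F (cube b r) volume)
    (hfin : ∫⁻ t in cube b r, ‖matPow (W t) (1 / p) * F t‖ₑ ^ p ≠ ⊤) :
    ∫⁻ x in cube b r, ‖matPow (W x) (1 / p) * ⨍ t in cube b r, F t‖ₑ ^ p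
      ≤ apConst p W * ∫⁻ t in cube b r, ‖matPow (W t) (1 / p) * F t‖ₑ ^ p := by
  have hp0 : 0 < p := by linarith
  have hv := volume_cube_ne_top b r
  have hv0 := volume_cube_ne_zero b hr
  have hvp : volume (cube b r) ^ p ≠ ⊤ := ENNReal.rpow_ne_top_of_nonneg hp0.le hv
  have hvp0 : volume (cube b r) ^ p ≠ 0 := by simp [hv0, hv]
  have hg : AEMeasurable (fun t => ‖matPow (W t) (1 / p) * F t‖ₑ) (volume.restrict (cube b r)) := by
    have hq := (hW.aestronglyMeasurable_matPow (1 / p)).restrict (s := cube b r) |>.prodMk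
      hF.aestronglyMeasurable
    have hc : Continuous fun q : Mat n × Mat n => q.1 * q.2 := continuous_mul
    have h := hc.comp_aestronglyMeasurable hq
    exact h.enorm
  have key := lintegral_rpow_lintegral_le hp hW hr subset_rfl hg hfin
  rw [← ENNReal.mul_le_mul_iff_right hvp0 hvp]
  refine le_trans ?_ (key.trans_eq (by ring))
  rw [← lintegral_const_mul' _ _ hvp]
  refine lintegral_mono fun x => ?_
  dsimp only
  rw [← ENNReal.mul_rpow_of_nonneg _ _ hp0.le]
  refine ENNReal.rpow_le_rpow ?_ hp0.le
  have hvol : volume (cube b r) * ‖matPow (W x) (1 / p) * ⨍ t in cube b r, F t‖ₑ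
      = ‖∫ t in cube b r, matPow (W x) (1 / p) * F t‖ₑ := by
    rw [integral_const_mul_of_integrable hF, ← measure_smul_setAverage F hv, mul_smul_comm,
      enorm_smul]
    congr 1
    rw [Real.enorm_eq_ofReal measureReal_nonneg, ofReal_measureReal hv]
  rw [hvol]
  refine (enorm_integral_le_lintegral_enorm _).trans (lintegral_mono_ae ?_)
  filter_upwards [ae_restrict_of_ae hW.posDef] with t ht
  exact enorm_mul_le_of_posDef ht _ _

end Ap

/-! ### Homogeneous kernels -/

section Kernel

variable {d : ℕ} {K : Eu d → ℂ}

/-- Homogeneity gives `K x = ‖x‖^(-d) K (x / ‖x‖)`, which spreads smoothness from the sphere to the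
punctured space. -/
theorem IsHomogeneousKernel.contDiffOn (hK : IsHomogeneousKernel K) :
    ContDiffOn ℝ ∞ K {0}ᶜ := by
  have hnorm : ContDiffOn ℝ ∞ (fun x : Eu d => ‖x‖) {0}ᶜ :=
    fun x hx => (contDiffAt_norm ℝ hx).contDiffWithinAt
  have hne : ∀ x ∈ ({0}ᶜ : Set (Eu d)), ‖x‖ ≠ 0 := fun x hx => norm_ne_zero_iff.2 hx
  have hdir : ContDiffOn ℝ ∞ (fun x : Eu d => ‖x‖⁻¹ • x) {0}ᶜ :=
    (hnorm.inv hne).smul contDiffOn_id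
  have hmaps : Set.MapsTo (fun x : Eu d => ‖x‖⁻¹ • x) {0}ᶜ (Metric.sphere 0 1) := fun x hx => by
    have := hne x hx
    rw [mem_sphere_zero_iff_norm, norm_smul, norm_inv, norm_norm, inv_mul_cancel₀ this]
  refine (((hnorm.pow d).inv fun x hx => pow_ne_zero _ (hne x hx)).smul
    (hK.smooth.comp hdir hmaps)).congr fun x hx => ?_
  have hx0 := hne x hx
  have h := hK.homogeneous ‖x‖ (norm_pos_iff.2 hx) (‖x‖⁻¹ • x)
    (smul_ne_zero (inv_ne_zero hx0) hx)
  rw [smul_inv_smul₀ hx0] at h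
  exact h

theorem IsHomogeneousKernel.continuousOn (hK : IsHomogeneousKernel K) : ContinuousOn K {0}ᶜ :=
  hK.contDiffOn.continuousOn

theorem IsHomogeneousKernel.measurable (hK : IsHomogeneousKernel K) : Measurable K :=
  measurable_of_continuousOn_compl_singleton 0 hK.continuousOn

/-- Near some point the kernel is inverted by a Schwartz function. -/
theorem IsHomogeneousKernel.exists_schwartz_inverse (hK : IsHomogeneousKernel K) :
    ∃ (z₀ : Eu d) (δ : ℝ) (φ : SchwartzMap (Eu d) ℂ), 0 < δ ∧ δ < ‖z₀‖ ∧
      ∀ z ∈ Metric.closedBall z₀ δ, K z * φ z = 1 := by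
  obtain ⟨z₀, hz₀, hKz⟩ := hK.ne_zero
  have hU : {z : Eu d | z ≠ 0 ∧ K z ≠ 0} ∈ 𝓝 z₀ :=
    inter_mem (isOpen_ne.mem_nhds hz₀)
      ((hK.continuousOn.continuousAt (isOpen_compl_singleton.mem_nhds hz₀)).eventually_ne hKz)
  obtain ⟨ε, hε, hball⟩ := Metric.nhds_basis_closedBall.mem_iff.1 hU
  have hε2 : ε / 2 < ε := by linarith
  let χ : ContDiffBump z₀ := ⟨ε / 2, ε, by linarith, hε2⟩
  have hsupp : HasCompactSupport fun z => (χ z : ℂ) * (K z)⁻¹ :=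
    (χ.hasCompactSupport.comp_left (g := ((↑) : ℝ → ℂ)) Complex.ofReal_zero).mul_right
  have hts : tsupport (fun z => (χ z : ℂ) * (K z)⁻¹) ⊆ Metric.closedBall z₀ ε := by
    refine closure_minimal (fun z hz => ?_) Metric.isClosed_closedBall
    have hχ : χ z ≠ 0 := fun h => hz (by simp [h])
    have : z ∈ Function.support χ := hχ
    rw [χ.support_eq] at this
    exact Metric.ball_subset_closedBall this
  have hsmooth : ContDiff ℝ ∞ fun z => (χ z : ℂ) * (K z)⁻¹ := by
    refine contDiff_iff_contDiffAt.2 fun z => ?_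
    -- Off the support the function vanishes locally; on it `K` is smooth and nonzero.
    by_cases hz : z ∈ tsupport fun z => (χ z : ℂ) * (K z)⁻¹
    swap
    · exact contDiffAt_const.congr_of_eventuallyEq (notMem_tsupport_iff_eventuallyEq.1 hz)
    obtain ⟨hz0, hKz0⟩ := hball (hts hz)
    exact (Complex.ofRealCLM.contDiff.contDiffAt.comp z χ.contDiff.contDiffAt).mul
      ((hK.contDiffOn.contDiffAt (isOpen_compl_singleton.mem_nhds hz0)).inv hKz0)
  refine ⟨z₀, ε / 2, hsupp.toSchwartzMap hsmooth, by linarith, ?_, fun z hz => ?_⟩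
  -- Otherwise the origin would lie in the ball of radius `ε`, all of whose points are nonzero.
  · by_contra! h
    have h0 : (0 : Eu d) ∈ Metric.closedBall z₀ ε := by
      rw [mem_closedBall_iff_norm, zero_sub, norm_neg]
      linarith
    exact (hball h0).1 rfl
  · have hz' := hball (Metric.closedBall_subset_closedBall hε2.le hz)
    have h1 : χ z = 1 := χ.one_of_mem_closedBall hz
    simp [h1, hz'.2]

/-- Fourier inversion with `ψ = 𝓕 φ`. Only the integrability of `ψ` matters later. -/
theorem exists_fourier_representation (φ : SchwartzMap (Eu d) ℂ) :
    ∃ ψ : Eu d → ℂ, Integrable ψ volume ∧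
      ∀ z, φ z = ∫ ξ, (Real.fourierChar (inner ℝ ξ z) : ℂ) * ψ ξ := by
  open FourierTransform in
  refine ⟨(𝓕 φ : SchwartzMap (Eu d) ℂ), (𝓕 φ : SchwartzMap (Eu d) ℂ).integrable, fun z => ?_⟩
  have h : 𝓕⁻ (𝓕 φ : SchwartzMap (Eu d) ℂ) = φ := fourierInv_fourier_eq φ
  conv_lhs => rw [← h]
  rw [SchwartzMap.fourierInv_coe, Real.fourierInv_eq]
  simp [Circle.smul_def]

end Kernel

/-! ### Riesz kernels -/

section Riesz

variable {d : ℕ}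

/-- The surface measure of a set is a multiple of the volume of the cone over it, and Lebesgue
measure is invariant under `x ↦ -x`. -/
theorem toSphere_neg_preimage (s : Set (Metric.sphere (0 : Eu d) 1)) (hs : MeasurableSet s) :
    (volume : Measure (Eu d)).toSphere ((fun θ => -θ) ⁻¹' s) =
      (volume : Measure (Eu d)).toSphere s := by
  have hm : Measurable fun θ : Metric.sphere (0 : Eu d) 1 => -θ := continuous_neg.measurable
  rw [Measure.toSphere_apply' _ hs, Measure.toSphere_apply' _ (hm hs)]
  congr 1
  rw [← Measure.measure_neg volume]
  congr 1
  ext x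
  simp only [Set.mem_neg, Set.mem_smul, Set.mem_image, Set.mem_preimage]
  constructor
  · rintro ⟨t, ht, _, ⟨θ, hθ, rfl⟩, h⟩
    exact ⟨t, ht, _, ⟨_, hθ, rfl⟩, by simp [h]⟩
  · rintro ⟨t, ht, _, ⟨θ, hθ, rfl⟩, h⟩
    exact ⟨t, ht, _, ⟨-θ, by simpa using hθ, rfl⟩, by simp [h]⟩

theorem integral_toSphere_eq_zero_of_odd {f : Eu d → ℂ} (hf : ∀ x, f (-x) = -f x) :
    ∫ θ : Metric.sphere (0 : Eu d) 1, f θ ∂(volume : Measure (Eu d)).toSphere = 0 := by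
  have hmp : MeasurePreserving (Homeomorph.neg (Metric.sphere (0 : Eu d) 1)).toMeasurableEquiv
      (volume : Measure (Eu d)).toSphere (volume : Measure (Eu d)).toSphere :=
    ⟨MeasurableEquiv.measurable _, Measure.ext fun s hs => by
      rw [Measure.map_apply (MeasurableEquiv.measurable _) hs]
      exact toSphere_neg_preimage s hs⟩
  have h := hmp.integral_comp' fun θ => f θ
  have h2 : ∀ θ : Metric.sphere (0 : Eu d) 1,
      f ((Homeomorph.neg (Metric.sphere (0 : Eu d) 1)).toMeasurableEquiv θ) = -f θ := fun θ => hf θ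
  simp only [h2, integral_neg] at h
  exact self_eq_neg.1 h.symm

theorem isHomogeneousKernel_rieszKernel (j : Fin d) : IsHomogeneousKernel (rieszKernel j) where
  ne_zero := by
    refine ⟨EuclideanSpace.single j 1, by simp, ?_⟩
    have h1 : 0 < Real.Gamma (((d : ℝ) + 1) / 2) := Real.Gamma_pos_of_pos (by positivity)
    have h2 : 0 < Real.pi ^ (((d : ℝ) + 1) / 2) := Real.rpow_pos_of_pos Real.pi_pos _
    simp only [rieszKernel, ne_eq, Complex.ofReal_eq_zero]
    simp [h1.ne', h2.ne']
  homogeneous t ht x hx := by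
    have hx0 : ‖x‖ ≠ 0 := norm_ne_zero_iff.2 hx
    simp only [rieszKernel, norm_smul, Real.norm_eq_abs, abs_of_pos ht, PiLp.smul_apply, smul_eq_mul]
    rw [Complex.real_smul, ← Complex.ofReal_mul]
    congr 1
    field_simp
    ring
  mean_zero := integral_toSphere_eq_zero_of_odd fun x => by
    simp only [rieszKernel, norm_neg, PiLp.neg_apply, neg_div, mul_neg, Complex.ofReal_neg]
  smooth := by
    intro x hx
    have hx0 : x ≠ 0 := ne_zero_of_mem_unit_sphere ⟨x, hx⟩
    refine ContDiffAt.contDiffWithinAt ?_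
    refine Complex.ofRealCLM.contDiff.contDiffAt.comp x (contDiffAt_const.mul ?_)
    exact ContDiffAt.div (by fun_prop) ((contDiffAt_norm ℝ hx0).pow _)
      (pow_ne_zero _ (norm_ne_zero_iff.2 hx0))

end Riesz

/-! ### The commutator on functions supported away from a point -/

section Commutator

variable {d n : ℕ} {K : Eu d → ℂ}

/-- Truncations with `ε < ρ` remove nothing from the integral, so the principal value is the limit
of an eventually constant function. -/
theorem czo_eq_integral {f : Eu d → Cv n} {x : Eu d} {ρ : ℝ} (hρ : 0 < ρ)
    (hf : ∀ y, ‖x - y‖ < ρ → f y = 0) : czo K f x = ∫ y, K (x - y) • f y := by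
  refine Tendsto.limUnder_eq (tendsto_const_nhds.congr' ?_)
  filter_upwards [Ioo_mem_nhdsGT hρ] with ε hε
  refine (setIntegral_eq_integral_of_forall_compl_eq_zero fun y hy => ?_).symm
  rw [hf y (lt_of_le_of_lt (not_lt.1 hy) hε.2), smul_zero]

theorem czoCommutator_eq_integral {B : Eu d → Mat n} {f : Eu d → Cv n} {x : Eu d} {ρ : ℝ}
    (hρ : 0 < ρ) (hf : ∀ y, ‖x - y‖ < ρ → f y = 0)
    (hint : Integrable (fun y => K (x - y) • f y) volume)
    (hBint : Integrable (fun y => K (x - y) • act (B y) (f y)) volume) :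
    czoCommutator K B f x = ∫ y, K (x - y) • act (B y - B x) (f y) := by
  have hact0 : ∀ A : Mat n, act A (0 : Cv n) = 0 := fun A => by simp [act]
  rw [czoCommutator, czo_eq_integral hρ hf, czo_eq_integral hρ fun y hy => by rw [hf y hy, hact0]]
  have h : act (B x) (∫ y, K (x - y) • f y) = ∫ y, act (B x) (K (x - y) • f y) :=
    ((Matrix.toEuclideanCLM (𝕜 := ℂ) (B x)).integral_comp_comm hint).symm
  have hint' : Integrable (fun y => act (B x) (K (x - y) • f y)) volume :=
    (Matrix.toEuclideanCLM (𝕜 := ℂ) (B x)).integrable_comp hint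
  rw [h, ← integral_sub hBint hint']
  refine integral_congr_ae (Eventually.of_forall fun y => ?_)
  simp only [act_smul, act_sub, smul_sub]

/-- The modulated characteristic function `1_E e^{-2πi ⟨ξ, λ y⟩} e`. -/
noncomputable def modulated (E : Set (Eu d)) (lam : ℝ) (ξ : Eu d) (e : Cv n) : Eu d → Cv n :=
  E.indicator fun y => (Real.fourierChar (-inner ℝ ξ (lam • y)) : ℂ) • e

theorem enorm_modulated {E : Set (Eu d)} {lam : ℝ} {ξ : Eu d} {e : Cv n} (A : Mat n) (y : Eu d) :
    ‖act A (modulated E lam ξ e y)‖ₑ = E.indicator (fun _ => ‖act A e‖ₑ) y := by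
  by_cases hy : y ∈ E
  · simp only [modulated, Set.indicator_of_mem hy, act_smul, enorm_smul]
    rw [enorm_eq_nnnorm, show ‖(Real.fourierChar (-inner ℝ ξ (lam • y)) : ℂ)‖₊ = 1 from
      NNReal.eq (Circle.norm_coe _)]
    simp
  · simp [modulated, Set.indicator_of_notMem hy, act]

theorem continuous_fourierChar_inner (lam : ℝ) :
    Continuous fun q : Eu d × Eu d => (Real.fourierChar (-inner ℝ q.1 (lam • q.2)) : ℂ) :=
  continuous_subtype_val.comp (Real.continuous_fourierChar.comp
    (continuous_fst.inner (continuous_snd.const_smul lam)).neg)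

theorem memLp_top_modulated {E : Set (Eu d)} (hE : MeasurableSet E) (lam : ℝ) (ξ : Eu d)
    (e : Cv n) : MemLp (modulated E lam ξ e) ⊤ volume := by
  have hc : Continuous fun y : Eu d => (Real.fourierChar (-inner ℝ ξ (lam • y)) : ℂ) • e :=
    ((continuous_fourierChar_inner lam).comp (Continuous.prodMk_right ξ)).smul continuous_const
  refine memLp_top_of_bound (hc.aestronglyMeasurable.indicator hE) ‖e‖
    (Eventually.of_forall fun y => ?_)
  refine (norm_indicator_le_norm_self _ _).trans ?_
  rw [norm_smul, Circle.norm_coe, one_mul]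

theorem hasCompactSupport_modulated {E : Set (Eu d)} (hE : Bornology.IsBounded E) (lam : ℝ)
    (ξ : Eu d) (e : Cv n) : HasCompactSupport (modulated E lam ξ e) :=
  (hE.isCompact_closure).of_isClosed_subset (isClosed_tsupport _)
    (closure_mono Set.support_indicator_subset)

/-- The character is unimodular, so the right side is free of `ξ` and `lam`: the commutator bound is
uniform in the frequency. -/
theorem weightedNorm_modulated {p : ℝ} (hp : 0 < p) (U : Eu d → Mat n) {E : Set (Eu d)}
    (hE : MeasurableSet E) (lam : ℝ) (ξ : Eu d) (e : Cv n) :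
    weightedNorm p U (modulated E lam ξ e) ^ p =
      ∫⁻ y in E, ‖act (matPow (U y) (1 / p)) e‖ₑ ^ p := by
  rw [weightedNorm, ← ENNReal.rpow_mul, one_div_mul_cancel hp.ne', ENNReal.rpow_one,
    ← lintegral_indicator hE]
  refine lintegral_congr fun y => ?_
  rw [enorm_modulated]
  by_cases hy : y ∈ E <;> simp [hy, hp]

theorem integrable_act {α : Type*} [MeasurableSpace α] {μ : Measure α} {B : α → Mat n}
    (hB : Integrable B μ) (e : Cv n) : Integrable (fun y => act (B y) e) μ := by
  have h := ((actL n).flip e).integrable_comp hB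
  exact h

/-- The commutator applied to `modulated J' lam ξ e`, at points away from `J'`. -/
theorem czoCommutator_modulated (hK : Measurable K) {B : Eu d → Mat n} {J' : Set (Eu d)}
    (hJ' : MeasurableSet J') (hfin : volume J' ≠ ⊤) (hBJ : IntegrableOn B J' volume)
    {x : Eu d} {ρ M : ℝ} (hρ : 0 < ρ)
    (hx : ∀ y ∈ J', ρ ≤ ‖x - y‖) (hM : ∀ y ∈ J', ‖K (x - y)‖ ≤ M) (lam : ℝ) (ξ : Eu d) (e : Cv n) :
    IntegrableOn (fun y => K (x - y) • act (B y - B x) e) J' volume ∧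
    czoCommutator K B (modulated J' lam ξ e) x =
      ∫ y in J', (Real.fourierChar (-inner ℝ ξ (lam • y)) : ℂ) •
        (K (x - y) • act (B y - B x) e) := by
  have hKm : AEStronglyMeasurable (fun y => K (x - y)) (volume.restrict J') :=
    (hK.comp (measurable_const.sub measurable_id)).aestronglyMeasurable
  have hKb : ∀ᵐ y ∂volume.restrict J', ‖K (x - y)‖ ≤ M :=
    (ae_restrict_iff' hJ').2 (Eventually.of_forall hM)
  have hχ : AEStronglyMeasurable (fun y : Eu d => (Real.fourierChar (-inner ℝ ξ (lam • y)) : ℂ))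
      (volume.restrict J') :=
    ((continuous_fourierChar_inner lam).comp (Continuous.prodMk_right ξ)).aestronglyMeasurable
  have hχb : ∀ᵐ y ∂volume.restrict J',
      ‖(Real.fourierChar (-inner ℝ ξ (lam • y)) : ℂ)‖ ≤ 1 :=
    Eventually.of_forall fun y => (Circle.norm_coe _).le
  have he : IntegrableOn (fun _ => e) J' volume := integrableOn_const hfin
  have hBe : IntegrableOn (fun y => act (B y) e) J' volume :=
    integrable_act hBJ e
  have hsub : IntegrableOn (fun y => act (B y - B x) e) J' volume := by
    simp only [act_sub]
    exact hBe.sub (integrableOn_const hfin)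
  refine ⟨hsub.bdd_smul _ hKm hKb, ?_⟩
  have hi1 : IntegrableOn (fun y => K (x - y) •
      (Real.fourierChar (-inner ℝ ξ (lam • y)) : ℂ) • e) J' volume :=
    (he.bdd_smul _ hχ hχb).bdd_smul _ hKm hKb
  have hi2 : IntegrableOn (fun y => K (x - y) •
      (Real.fourierChar (-inner ℝ ξ (lam • y)) : ℂ) • act (B y) e) J' volume :=
    (hBe.bdd_smul _ hχ hχb).bdd_smul _ hKm hKb
  have hact0 : ∀ A : Mat n, act A (0 : Cv n) = 0 := fun A => by simp [act]
  rw [czoCommutator_eq_integral hρ, ← integral_indicator hJ']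
  · refine integral_congr_ae (Eventually.of_forall fun y => ?_)
    by_cases hy : y ∈ J'
    · simp only [modulated, Set.indicator_of_mem hy, act_smul]
      rw [smul_comm]
    · simp [modulated, Set.indicator_of_notMem hy, hact0]
  · exact fun y hy => Set.indicator_of_notMem (fun hyJ => absurd (hx y hyJ) (not_le.2 hy)) _
  · rw [← integrable_indicator_iff hJ'] at hi1
    refine hi1.congr (Eventually.of_forall fun y => ?_)
    by_cases hy : y ∈ J' <;> simp [modulated, hy]
  · rw [← integrable_indicator_iff hJ'] at hi2
    refine hi2.congr (Eventually.of_forall fun y => ?_)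
    by_cases hy : y ∈ J' <;> simp [modulated, hy, act_smul, hact0]

end Commutator

/-! ### The mean oscillation estimate -/

section Oscillation

variable {d n : ℕ} {K : Eu d → ℂ}

/-- Expand `φ (lam • (x - y))` in characters, split each into a factor in `x` and a factor in `y`,
and apply Fubini; the factor in `x` has modulus one. -/
theorem enorm_integral_fourier_le {μ : Measure (Eu d)} [SFinite μ] {φ ψ : Eu d → ℂ}
    (hψ : Integrable ψ volume)
    (hφ : ∀ z, φ z = ∫ ξ, (Real.fourierChar (inner ℝ ξ z) : ℂ) * ψ ξ) {h : Eu d → Cv n}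
    (hh : Integrable h μ) (lam : ℝ) (x : Eu d) :
    ‖∫ y, φ (lam • (x - y)) • h y ∂μ‖ₑ ≤
      ∫⁻ ξ, ‖ψ ξ‖ₑ * ‖∫ y, (Real.fourierChar (-inner ℝ ξ (lam • y)) : ℂ) • h y ∂μ‖ₑ := by
  have hsplit : ∀ y, φ (lam • (x - y)) • h y = ∫ ξ, (Real.fourierChar (inner ℝ ξ (lam • x)) : ℂ) •
      (Real.fourierChar (-inner ℝ ξ (lam • y)) : ℂ) • ψ ξ • h y := fun y => by
    rw [hφ, ← integral_smul_const]
    refine integral_congr_ae (Eventually.of_forall fun ξ => ?_)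
    simp only [smul_smul]
    congr 1
    rw [smul_sub, inner_sub_right, sub_eq_add_neg, AddChar.map_add_eq_mul, Circle.coe_mul, mul_assoc]
  have hc1 : Continuous fun q : Eu d × Eu d => (Real.fourierChar (inner ℝ q.1 (lam • x)) : ℂ) :=
    continuous_subtype_val.comp (Real.continuous_fourierChar.comp
      (continuous_fst.inner continuous_const))
  have hint : Integrable (fun q : Eu d × Eu d => (Real.fourierChar (inner ℝ q.1 (lam • x)) : ℂ) •
      (Real.fourierChar (-inner ℝ q.1 (lam • q.2)) : ℂ) • ψ q.1 • h q.2) (volume.prod μ) :=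
    (((hψ.smul_prod hh).bdd_smul 1 (continuous_fourierChar_inner lam).aestronglyMeasurable
      (Eventually.of_forall fun q => (Circle.norm_coe _).le)).bdd_smul 1 hc1.aestronglyMeasurable
      (Eventually.of_forall fun q => (Circle.norm_coe _).le))
  simp_rw [hsplit]
  rw [← integral_integral_swap (μ := volume) (ν := μ) hint]
  refine (enorm_integral_le_lintegral_enorm _).trans (lintegral_mono fun ξ => le_of_eq ?_)
  dsimp only
  have h1 : ∀ y, (Real.fourierChar (-inner ℝ ξ (lam • y)) : ℂ) • ψ ξ • h y =
      ψ ξ • (Real.fourierChar (-inner ℝ ξ (lam • y)) : ℂ) • h y := fun y => smul_comm _ _ _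
  simp_rw [h1, integral_smul, enorm_smul]
  rw [enorm_eq_nnnorm (Real.fourierChar _ : ℂ), show ‖(Real.fourierChar (inner ℝ ξ (lam • x)) : ℂ)‖₊ = 1
    from NNReal.eq (Circle.norm_coe _)]
  simp

theorem integral_act_sub {B : Eu d → Mat n} {J' : Set (Eu d)} (hfin : volume J' ≠ ⊤)
    (hB : IntegrableOn B J' volume) (A : Mat n) (x : Eu d) (e : Cv n) :
    ∫ y in J', act A (act (B y - B x) e) =
      -(volume.real J' • act A (act (B x - ⨍ y in J', B y) e)) := by
  have hBx : IntegrableOn (fun _ => B x) J' volume := integrableOn_const hfin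
  have h1 : ∫ y in J', act (B y - B x) e = act (∫ y in J', (B y - B x)) e := by
    have h := ((actL n).flip e).integral_comp_comm (hB.sub hBx)
    exact h
  have h2 : ∫ y in J', act A (act (B y - B x) e) = act A (∫ y in J', act (B y - B x) e) :=
    (Matrix.toEuclideanCLM (𝕜 := ℂ) A).integral_comp_comm (integrable_act (hB.sub hBx) e)
  have h3 : ∫ y in J', (B y - B x) = -(volume.real J' • (B x - ⨍ y in J', B y)) := by
    rw [integral_sub hB hBx, setIntegral_const, smul_sub, measure_smul_setAverage B hfin]
    abel
  rw [h2, h1, h3]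
  simp [act, ← Complex.coe_smul, -Matrix.toEuclideanCLM_toLp]

/-- The pointwise form of the representation of the oscillation of `B` by commutators. -/
theorem enorm_oscillation_le {φ ψ : Eu d → ℂ} (hψ : Integrable ψ volume)
    (hφ : ∀ z, φ z = ∫ ξ, (Real.fourierChar (inner ℝ ξ z) : ℂ) * ψ ξ)
    {B : Eu d → Mat n} {J' : Set (Eu d)} (hJ' : MeasurableSet J') (hfin : volume J' ≠ ⊤)
    (hB : IntegrableOn B J' volume) {x : Eu d} {lam c : ℝ} {e : Cv n}
    (hint : IntegrableOn (fun y => K (x - y) • act (B y - B x) e) J' volume)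
    (hc : ∀ y ∈ J', K (x - y) * φ (lam • (x - y)) = c) (A : Mat n) :
    ‖c‖ₑ * volume J' * ‖act A (act (B x - ⨍ y in J', B y) e)‖ₑ ≤
      ∫⁻ ξ, ‖ψ ξ‖ₑ * ‖act A (∫ y in J', (Real.fourierChar (-inner ℝ ξ (lam • y)) : ℂ) •
        (K (x - y) • act (B y - B x) e))‖ₑ := by
  have hA : ∀ ξ : Eu d, act A (∫ y in J', (Real.fourierChar (-inner ℝ ξ (lam • y)) : ℂ) •
        (K (x - y) • act (B y - B x) e)) = ∫ y in J',
          (Real.fourierChar (-inner ℝ ξ (lam • y)) : ℂ) •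
            act A (K (x - y) • act (B y - B x) e) := fun ξ => by
    have hχ : AEStronglyMeasurable (fun y : Eu d => (Real.fourierChar (-inner ℝ ξ (lam • y)) : ℂ))
        (volume.restrict J') :=
      ((continuous_fourierChar_inner lam).comp (Continuous.prodMk_right ξ)).aestronglyMeasurable
    have h := (Matrix.toEuclideanCLM (𝕜 := ℂ) A).integral_comp_comm
      (hint.bdd_smul 1 hχ (Eventually.of_forall fun y => (Circle.norm_coe _).le))
    simp_rw [← act_smul A]
    exact h.symm
  have hh : IntegrableOn (fun y => act A (K (x - y) • act (B y - B x) e)) J' volume :=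
    (Matrix.toEuclideanCLM (𝕜 := ℂ) A).integrable_comp hint
  simp_rw [hA]
  refine le_trans (le_of_eq ?_) (enorm_integral_fourier_le hψ hφ hh lam x)
  -- By `hc` the factor `φ` cancels the kernel, leaving a constant.
  have h1 : ∫ y in J', φ (lam • (x - y)) • act A (K (x - y) • act (B y - B x) e) =
      ∫ y in J', (c : ℂ) • act A (act (B y - B x) e) := by
    refine setIntegral_congr_fun hJ' fun y hy => ?_
    rw [act_smul, smul_smul, mul_comm, hc y hy]
  rw [h1, integral_smul, integral_act_sub hfin hB, enorm_smul, enorm_neg, enorm_smul, mul_assoc,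
    Real.enorm_eq_ofReal measureReal_nonneg, ofReal_measureReal hfin]
  congr 1
  rw [enorm_eq_nnnorm, enorm_eq_nnnorm, Complex.nnnorm_real]

/-- Joint measurability in `(x, ξ)`, required to interchange the two integrals by Tonelli. -/
theorem aestronglyMeasurable_commutator_integral (hK : Measurable K) {A B : Eu d → Mat n}
    (hA : AEStronglyMeasurable A volume) (hB : AEStronglyMeasurable B volume) (J J' : Set (Eu d))
    (lam : ℝ) (e : Cv n) :
    AEStronglyMeasurable (fun q : Eu d × Eu d => act (A q.1) (∫ y in J',
      (Real.fourierChar (-inner ℝ q.2 (lam • y)) : ℂ) • (K (q.1 - y) • act (B y - B q.1) e)))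
      ((volume.restrict J).prod volume) := by
  have hE : AEStronglyMeasurable (fun q : (Eu d × Eu d) × Eu d =>
      (Real.fourierChar (-inner ℝ q.1.2 (lam • q.2)) : ℂ))
      (((volume.restrict J).prod volume).prod (volume.restrict J')) :=
    ((continuous_fourierChar_inner lam).comp
      ((continuous_snd.comp continuous_fst).prodMk continuous_snd)).aestronglyMeasurable
  have hKm : AEStronglyMeasurable (fun q : (Eu d × Eu d) × Eu d => K (q.1.1 - q.2))
      (((volume.restrict J).prod volume).prod (volume.restrict J')) :=
    (hK.comp (((measurable_fst.comp measurable_fst).sub measurable_snd))).aestronglyMeasurable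
  have hBy : AEStronglyMeasurable (fun q : (Eu d × Eu d) × Eu d => B q.2)
      (((volume.restrict J).prod volume).prod (volume.restrict J')) :=
    hB.restrict.comp_snd
  have hBx : AEStronglyMeasurable (fun q : (Eu d × Eu d) × Eu d => B q.1.1)
      (((volume.restrict J).prod volume).prod (volume.restrict J')) :=
    (hB.restrict (s := J)).comp_fst.comp_fst
  have hact := aestronglyMeasurable_act (hBy.sub hBx) (aestronglyMeasurable_const (b := e))
  exact aestronglyMeasurable_act (hA.restrict (s := J)).comp_fst
    (hE.smul (hKm.smul hact)).integral_prod_right'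

end Oscillation

/-! ### From commutator bounds to the two weight BMO condition. -/

section Main

variable {d n : ℕ} {p : ℝ} {K : Eu d → ℂ} {B U W : Eu d → Mat n}

/-- The pointwise bound of `enorm_oscillation_le` is raised to the power `p` by Jensen in `ξ` and
integrated over `J`; for each fixed `ξ` the commutator bound applies. -/
theorem lintegral_oscillation_le_of_geometry (hp : 1 < p) (hK : Measurable K)
    (hW : IsMatrixWeight W) (hBm : AEStronglyMeasurable B volume) {C : ℝ≥0}
    (hC : ∀ f : Eu d → Cv n, MemLp f ⊤ volume → HasCompactSupport f →
      weightedNorm p W (czoCommutator K B f) ≤ C * weightedNorm p U f)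
    {φ ψ : Eu d → ℂ} (hψ : Integrable ψ volume)
    (hφ : ∀ z, φ z = ∫ ξ, (Real.fourierChar (inner ℝ ξ z) : ℂ) * ψ ξ)
    {J J' : Set (Eu d)} (hJ : MeasurableSet J) (hJ' : MeasurableSet J')
    (hbdd : Bornology.IsBounded J') (hfin : volume J' ≠ ⊤) (hB : IntegrableOn B J' volume)
    {lam c ρ M : ℝ} (hρ : 0 < ρ) (hdist : ∀ x ∈ J, ∀ y ∈ J', ρ ≤ ‖x - y‖)
    (hM : ∀ x ∈ J, ∀ y ∈ J', ‖K (x - y)‖ ≤ M)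
    (hc : ∀ x ∈ J, ∀ y ∈ J', K (x - y) * φ (lam • (x - y)) = c) (e : Cv n) :
    (‖c‖ₑ * volume J') ^ p *
      ∫⁻ x in J, ‖act (matPow (W x) (1 / p)) (act (B x - ⨍ y in J', B y) e)‖ₑ ^ p ≤
    ((∫⁻ ξ, ‖ψ ξ‖ₑ) ^ (p - 1) * (∫⁻ ξ, ‖ψ ξ‖ₑ) * (C : ℝ≥0∞) ^ p) *
      ∫⁻ y in J', ‖act (matPow (U y) (1 / p)) e‖ₑ ^ p := by
  have hp0 : 0 < p := by linarith
  set L := ∫⁻ ξ, ‖ψ ξ‖ₑ with hL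
  have hLtop : L ≠ ⊤ := hψ.hasFiniteIntegral.ne
  set I := ∫⁻ y in J', ‖act (matPow (U y) (1 / p)) e‖ₑ ^ p with hI
  set H : Eu d → Eu d → Cv n := fun x ξ => act (matPow (W x) (1 / p)) (∫ y in J',
    (Real.fourierChar (-inner ℝ ξ (lam • y)) : ℂ) • (K (x - y) • act (B y - B x) e)) with hH
  have hHm : AEStronglyMeasurable (fun q : Eu d × Eu d => H q.1 q.2)
      ((volume.restrict J).prod volume) :=
    aestronglyMeasurable_commutator_integral hK (hW.aestronglyMeasurable_matPow _) hBm J J' lam e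
  have hcomm : ∀ x ∈ J, ∀ ξ,
      act (matPow (W x) (1 / p)) (czoCommutator K B (modulated J' lam ξ e) x) = H x ξ :=
    fun x hx ξ => by
      rw [(czoCommutator_modulated hK hJ' hfin hB hρ (hdist x hx) (hM x hx) lam ξ e).2]
  have hpt : ∀ x ∈ J, ‖c‖ₑ * volume J' *
      ‖act (matPow (W x) (1 / p)) (act (B x - ⨍ y in J', B y) e)‖ₑ ≤
        ∫⁻ ξ, ‖ψ ξ‖ₑ * ‖H x ξ‖ₑ := fun x hx =>
    enorm_oscillation_le hψ hφ hJ' hfin hB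
      -- The integrability does not involve the frequency; `0` is an arbitrary choice.
      (czoCommutator_modulated hK hJ' hfin hB hρ (hdist x hx) (hM x hx) lam 0 e).1 (hc x hx) _
  have hbound : ∀ ξ, ∫⁻ x in J, ‖H x ξ‖ₑ ^ p ≤ (C : ℝ≥0∞) ^ p * I := fun ξ => by
    have h1 := ENNReal.rpow_le_rpow (hC _ (memLp_top_modulated hJ' lam ξ e)
      (hasCompactSupport_modulated hbdd lam ξ e)) hp0.le
    rw [ENNReal.mul_rpow_of_nonneg _ _ hp0.le, weightedNorm_modulated hp0 U hJ', weightedNorm,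
      ← ENNReal.rpow_mul, one_div_mul_cancel hp0.ne', ENNReal.rpow_one] at h1
    refine le_trans ?_ h1
    refine (lintegral_mono_ae ?_).trans (setLIntegral_le_lintegral J _)
    refine (ae_restrict_iff' hJ).2 (Eventually.of_forall fun x hx => ?_)
    rw [hcomm x hx]
  have hctop : (‖c‖ₑ * volume J') ^ p ≠ ⊤ :=
    ENNReal.rpow_ne_top_of_nonneg hp0.le (ENNReal.mul_ne_top enorm_ne_top hfin)
  have hψm : AEMeasurable (fun ξ => ‖ψ ξ‖ₑ) volume := hψ.aestronglyMeasurable.enorm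
  calc _ = ∫⁻ x in J, (‖c‖ₑ * volume J' *
          ‖act (matPow (W x) (1 / p)) (act (B x - ⨍ y in J', B y) e)‖ₑ) ^ p := by
        rw [← lintegral_const_mul' _ _ hctop]
        simp_rw [ENNReal.mul_rpow_of_nonneg _ _ hp0.le]
    _ ≤ ∫⁻ x in J, L ^ (p - 1) * ∫⁻ ξ, ‖ψ ξ‖ₑ * ‖H x ξ‖ₑ ^ p := by
        refine lintegral_mono_ae ?_
        filter_upwards [hHm.prodMk_left, ae_restrict_mem hJ] with x hxm hxJ
        exact (ENNReal.rpow_le_rpow (hpt x hxJ) hp0.le).trans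
          (lintegral_weight_mul_rpow_le hp hψm hxm.enorm)
    _ = L ^ (p - 1) * ∫⁻ ξ, ∫⁻ x in J, ‖ψ ξ‖ₑ * ‖H x ξ‖ₑ ^ p := by
        rw [lintegral_const_mul' _ _ (ENNReal.rpow_ne_top_of_nonneg (by linarith) hLtop)]
        congr 1
        refine lintegral_lintegral_swap ?_
        exact (hψ.aestronglyMeasurable.comp_snd).enorm.mul (hHm.enorm.pow_const p)
    _ ≤ L ^ (p - 1) * ∫⁻ ξ, ‖ψ ξ‖ₑ * ((C : ℝ≥0∞) ^ p * I) := by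
        gcongr with ξ
        rw [lintegral_const_mul' _ _ enorm_ne_top]
        gcongr
        exact hbound ξ
    _ = _ := by
        rw [lintegral_mul_const'' _ hψm]
        ring

/-- Supplies the geometry: `J'` is `J` translated by `-z₀ / lam`, with `lam` inversely proportional
to the side `r`. -/
theorem exists_lintegral_oscillation_le (hp : 1 < p) (hK : IsHomogeneousKernel K)
    (hW : IsMatrixWeight W) (hB : LocallyIntegrable B volume) (hC : CommutatorBounded p K B U W) :
    ∃ (κ : ℝ) (D : ℝ≥0∞), 0 ≤ κ ∧ D ≠ ⊤ ∧ ∀ (a : Eu d) (r : ℝ), 0 < r →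
      ∃ v : Eu d, ‖v‖ ≤ κ * r ∧ ∀ e : Cv n,
        ∫⁻ x in cube a r,
          ‖act (matPow (W x) (1 / p)) (act (B x - ⨍ y in cube (a + v) r, B y) e)‖ₑ ^ p ≤
        D * ∫⁻ y in cube (a + v) r, ‖act (matPow (U y) (1 / p)) e‖ₑ ^ p := by
  have hp0 : 0 < p := by linarith
  obtain ⟨C, hC⟩ := hC
  obtain ⟨z₀, δ, φ, hδ, hδz, hinv⟩ := hK.exists_schwartz_inverse
  obtain ⟨ψ, hψ, hφ⟩ := exists_fourier_representation φ
  have hball : Metric.closedBall z₀ δ ⊆ {0}ᶜ := fun z hz h0 => by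
    have hz' : z = 0 := h0
    rw [hz', mem_closedBall_iff_norm, zero_sub, norm_neg] at hz
    linarith
  obtain ⟨M, hM⟩ := (isCompact_closedBall z₀ δ).exists_bound_of_continuousOn
    (hK.continuousOn.mono hball)
  -- Chosen so that a cube of diameter at most `r * √d`, rescaled by `lam = s / r`, has diameter at
  -- most `δ`.
  set s : ℝ := δ / (√d + 1) with hs
  have hsqrt : 0 ≤ √(d : ℝ) := Real.sqrt_nonneg _
  have hs0 : 0 < s := by positivity
  have hsδ : s * √d ≤ δ := by
    rw [hs, div_mul_eq_mul_div, div_le_iff₀ (by positivity)]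
    nlinarith
  set L := ∫⁻ ξ, ‖ψ ξ‖ₑ with hL
  have hLtop : L ≠ ⊤ := hψ.hasFiniteIntegral.ne
  set S : ℝ≥0∞ := ENNReal.ofReal s ^ d with hS
  have hS0 : S ≠ 0 := by simp [hS, hs0]
  have hStop : S ≠ ⊤ := by simp [hS]
  have hSp0 : S ^ p ≠ 0 := by simp [ENNReal.rpow_eq_zero_iff, hS0, hStop]
  have hSptop : S ^ p ≠ ⊤ := ENNReal.rpow_ne_top_of_nonneg hp0.le hStop
  refine ⟨‖z₀‖ / s, (S ^ p)⁻¹ * (L ^ (p - 1) * L * (C : ℝ≥0∞) ^ p), by positivity, ?_,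
    fun a r hr => ?_⟩
  · exact ENNReal.mul_ne_top (ENNReal.inv_ne_top.2 hSp0) (ENNReal.mul_ne_top (ENNReal.mul_ne_top
      (ENNReal.rpow_ne_top_of_nonneg (by linarith) hLtop) hLtop)
      (ENNReal.rpow_ne_top_of_nonneg hp0.le ENNReal.coe_ne_top))
  set lam : ℝ := s / r with hlam
  have hlam0 : 0 < lam := by positivity
  have hdiff : ∀ x ∈ cube a r, ∀ y ∈ cube (a + -(lam⁻¹ • z₀)) r,
      lam • (x - y) ∈ Metric.closedBall z₀ δ := fun x hx y hy => by
    have hy' : y + lam⁻¹ • z₀ ∈ cube a r := by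
      rw [← add_mem_cube_iff (v := -(lam⁻¹ • z₀))]
      simpa using hy
    have h1 := norm_sub_le_of_mem_cube hx hy'
    have h2 : lam • (x - y) - z₀ = lam • (x - (y + lam⁻¹ • z₀)) := by
      rw [← sub_sub, smul_sub lam (x - y), smul_inv_smul₀ hlam0.ne']
    rw [mem_closedBall_iff_norm, h2, norm_smul, Real.norm_eq_abs, abs_of_pos hlam0]
    calc lam * ‖x - (y + lam⁻¹ • z₀)‖ ≤ lam * (r * √d) := by gcongr
      _ = s * √d := by rw [hlam]; field_simp
      _ ≤ δ := hsδ
  have hKhom : ∀ z, lam • z ∈ Metric.closedBall z₀ δ →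
      K z = ((lam ^ d : ℝ) : ℂ) * K (lam • z) := fun z hz => by
    have hz0 : z ≠ 0 := fun h0 => hball hz (by simp [h0])
    rw [hK.homogeneous lam hlam0 z hz0, ← Complex.real_smul, smul_inv_smul₀ (by positivity)]
  refine ⟨-(lam⁻¹ • z₀), le_of_eq ?_, fun e => ?_⟩
  · rw [norm_neg, norm_smul, norm_inv, Real.norm_eq_abs, abs_of_pos hlam0, hlam]
    field_simp
  have key := lintegral_oscillation_le_of_geometry (U := U) (J := cube a r)
    (J' := cube (a + -(lam⁻¹ • z₀)) r) (c := lam ^ d) (ρ := (‖z₀‖ - δ) / lam)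
    (M := lam ^ d * M) (lam := lam) hp hK.measurable hW
    hB.aestronglyMeasurable hC hψ hφ (measurableSet_cube _ _) (measurableSet_cube _ _)
    (Metric.isBounded_closedBall.subset (cube_subset_closedBall _ hr)) (volume_cube_ne_top _ _)
    (integrableOn_cube hB _ hr) (div_pos (by linarith) hlam0) (fun x hx y hy => ?_)
    (fun x hx y hy => ?_) (fun x hx y hy => ?_) e
  -- `lam ^ d |J'| = s ^ d` does not depend on the cube, which makes `D` uniform.
  · have hcS : ‖lam ^ d‖ₑ * volume (cube (a + -(lam⁻¹ • z₀)) r) = S := by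
      rw [volume_cube, Real.enorm_eq_ofReal (by positivity), ENNReal.ofReal_pow hlam0.le, ← mul_pow,
        ← ENNReal.ofReal_mul hlam0.le, hlam, div_mul_cancel₀ _ hr.ne']
    rw [hcS] at key
    rw [mul_assoc, ← ENNReal.mul_le_iff_le_inv hSp0 hSptop]
    exact key
  · have h := mem_closedBall_iff_norm.1 (hdiff x hx y hy)
    have h1 : ‖z₀‖ ≤ ‖lam • (x - y)‖ + ‖lam • (x - y) - z₀‖ := by
      have := norm_sub_le (lam • (x - y)) (lam • (x - y) - z₀)
      rwa [sub_sub_cancel] at this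
    rw [norm_smul, Real.norm_eq_abs, abs_of_pos hlam0] at h1
    rw [div_le_iff₀ hlam0]
    linarith
  · rw [hKhom _ (hdiff x hx y hy), norm_mul, Complex.norm_real, Real.norm_eq_abs,
      abs_of_pos (by positivity)]
    gcongr
    exact hM _ (hdiff x hx y hy)
  · rw [hKhom _ (hdiff x hx y hy), mul_assoc, hinv _ (hdiff x hx y hy), mul_one]

theorem lintegral_enorm_rpow_le_sum (hp : 1 < p) {μ : Measure (Eu d)} {F : Eu d → Mat n}
    (hF : ∀ i, AEMeasurable (fun x => ‖act (F x) (EuclideanSpace.single i (1 : ℂ))‖ₑ) μ) :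
    ∫⁻ x, ‖F x‖ₑ ^ p ∂μ ≤ (n : ℝ≥0∞) ^ (p - 1) *
      ∑ i, ∫⁻ x, ‖act (F x) (EuclideanSpace.single i (1 : ℂ))‖ₑ ^ p ∂μ := by
  have hp0 : 0 < p := by linarith
  rw [← lintegral_finsetSum' _ fun i _ => (hF i).pow_const p,
    ← lintegral_const_mul' _ _ (ENNReal.rpow_ne_top_of_nonneg (by linarith) (by simp))]
  refine lintegral_mono fun x => ?_
  refine (ENNReal.rpow_le_rpow (opNorm_le_sum_act_basis (F x)) hp0.le).trans ?_
  have h := ENNReal.rpow_sum_le_const_mul_sum_rpow (Finset.univ : Finset (Fin n))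
    (fun i => ‖act (F x) (EuclideanSpace.single i (1 : ℂ))‖ₑ) hp.le
  simpa using h

theorem twoWeightBMO_of_commutatorBounded (hp : 1 < p) (hU : IsMatrixAp p U) (hW : IsMatrixAp p W)
    (hB : LocallyIntegrable B volume) (hK : IsHomogeneousKernel K)
    (hC : CommutatorBounded p K B U W) {𝒬 : Set (Set (Eu d))} (h𝒬 : 𝒬 ⊆ allCubes d) :
    TwoWeightBMO p W U 𝒬 B := by
  have hp0 : 0 < p := by linarith
  rintro V ⟨_, C, -, hV⟩
  obtain ⟨κ, D, hκ, hD, hosc⟩ :=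
    exists_lintegral_oscillation_le hp hK hW.toIsMatrixWeight hB hC
  -- The `p`-th power of the volume ratio between the common cube of `J`, `J'` and `J` itself.
  set R : ℝ≥0∞ := (ENNReal.ofReal (2 * κ + 1) ^ d) ^ p with hR
  have hRtop : R ≠ ⊤ := ENNReal.rpow_ne_top_of_nonneg hp0.le (by simp)
  -- the bound for the oscillation around the average over the translated cube
  set E : ℝ≥0∞ := (n : ℝ≥0∞) ^ (p - 1) * (n * (D * (apConst p U * R * (C : ℝ≥0∞) ^ p))) with hE
  have hEtop : E ≠ ⊤ := ENNReal.mul_ne_top (ENNReal.rpow_ne_top_of_nonneg (by linarith) (by simp))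
    (ENNReal.mul_ne_top (by simp) (ENNReal.mul_ne_top hD (ENNReal.mul_ne_top
      (ENNReal.mul_ne_top hU.apConst_lt_top.ne hRtop)
      (ENNReal.rpow_ne_top_of_nonneg hp0.le ENNReal.coe_ne_top))))
  refine lt_of_le_of_lt (b := (2 : ℝ≥0∞) ^ (p - 1) * (E + apConst p W * E))
    (iSup₂_le fun J hJ => ?_) (ENNReal.mul_lt_top
      (ENNReal.rpow_lt_top_of_nonneg (by linarith) (by simp))
      (ENNReal.add_lt_top.2 ⟨hEtop.lt_top, ENNReal.mul_lt_top hW.apConst_lt_top hEtop.lt_top⟩))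
  obtain ⟨a, r, hr, rfl⟩ := h𝒬 hJ
  have hvtop := volume_cube_ne_top a r
  have hv0 := volume_cube_ne_zero a hr
  obtain ⟨v, hv, hosc⟩ := hosc a r hr
  obtain ⟨b, hb, hb'⟩ := exists_common_cube a v hr hκ hv
  have hr' : 0 < (2 * κ + 1) * r := by positivity
  -- the reducing operators control the averages over the cube
  have hred : ∀ e : Cv n, ∫⁻ x in cube a r, ‖act (matPow (U x) (1 / p)) e‖ₑ ^ p ≤
      volume (cube a r) * ((C : ℝ≥0∞) ^ p * ‖act (V (cube a r)) e‖ₑ ^ p) := fun e => by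
    have h := ENNReal.rpow_le_rpow (hV _ hJ e).2 hp0.le
    rw [← ENNReal.rpow_mul, one_div_mul_cancel hp0.ne', ENNReal.rpow_one,
      ENNReal.mul_rpow_of_nonneg _ _ hp0.le] at h
    rw [lintegral_eq_measure_mul_laverage hvtop]
    gcongr
  have hredtop : ∀ e : Cv n, ∫⁻ x in cube a r, ‖act (matPow (U x) (1 / p)) e‖ₑ ^ p ≠ ⊤ := fun e =>
    ne_top_of_le_ne_top (ENNReal.mul_ne_top hvtop (ENNReal.mul_ne_top
      (ENNReal.rpow_ne_top_of_nonneg hp0.le ENNReal.coe_ne_top)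
      (ENNReal.rpow_ne_top_of_nonneg hp0.le enorm_ne_top))) (hred e)
  have hdoub : ∀ e : Cv n, ∫⁻ x in cube (a + v) r, ‖act (matPow (U x) (1 / p)) e‖ₑ ^ p ≤
      apConst p U * R * ∫⁻ x in cube a r, ‖act (matPow (U x) (1 / p)) e‖ₑ ^ p := fun e => by
    have h := doubling_lintegral_act hp hU.toIsMatrixWeight hr' hb e (hredtop e)
    have hvol : volume (cube b ((2 * κ + 1) * r)) ^ p = R * volume (cube a r) ^ p := by
      rw [volume_cube, volume_cube, ENNReal.ofReal_mul (by positivity), mul_pow,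
        ENNReal.mul_rpow_of_nonneg _ _ hp0.le]
    have hvp0 : volume (cube a r) ^ p ≠ 0 := by simp [ENNReal.rpow_eq_zero_iff, hv0, hvtop]
    have hvptop : volume (cube a r) ^ p ≠ ⊤ := ENNReal.rpow_ne_top_of_nonneg hp0.le hvtop
    rw [← ENNReal.mul_le_mul_iff_right hvp0 hvptop]
    calc _ ≤ _ := mul_le_mul_right (lintegral_mono_set hb') _
      _ ≤ _ := h
      _ = _ := by rw [hvol]; ring
  set m := ⨍ y in cube (a + v) r, B y with hm
  set Vi := (V (cube a r))⁻¹ with hVi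
  set F : Eu d → Mat n := fun x => (B x - m) * Vi with hF
  have hBJ : IntegrableOn B (cube a r) volume := integrableOn_cube hB a hr
  have hcJ : IntegrableOn (fun _ : Eu d => m) (cube a r) volume := integrableOn_const hvtop
  have hFint : IntegrableOn F (cube a r) volume := (hBJ.sub hcJ).mul_const Vi
  have hWm := (hW.toIsMatrixWeight.aestronglyMeasurable_matPow (1 / p)).restrict (s := cube a r)
  have hWF : AEStronglyMeasurable (fun x => matPow (W x) (1 / p) * F x)
      (volume.restrict (cube a r)) := by
    have hc : Continuous fun q : Mat n × Mat n => q.1 * q.2 := continuous_mul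
    have h := hc.comp_aestronglyMeasurable (hWm.prodMk hFint.aestronglyMeasurable)
    exact h
  have hFE : ∫⁻ x in cube a r, ‖matPow (W x) (1 / p) * F x‖ₑ ^ p ≤ volume (cube a r) * E := by
    refine (lintegral_enorm_rpow_le_sum hp fun i =>
      (aestronglyMeasurable_act hWF aestronglyMeasurable_const).enorm).trans ?_
    have hcol : ∀ i : Fin n, ∫⁻ x in cube a r,
        ‖act (matPow (W x) (1 / p) * F x) (EuclideanSpace.single i (1 : ℂ))‖ₑ ^ p ≤
          volume (cube a r) * (D * (apConst p U * R * (C : ℝ≥0∞) ^ p)) := fun i => by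
      -- The test vector is the `i`-th column of `V_J⁻¹`, so the reducing operator sends it into the
      -- unit ball.
      have hone : ‖act (V (cube a r)) (act Vi (EuclideanSpace.single i (1 : ℂ)))‖ₑ ^ p ≤ 1 := by
        refine ENNReal.rpow_le_one ?_ hp0.le
        rw [← act_mul]
        refine (norm_act_le _ _).trans ?_
        refine (mul_le_mul' (enorm_mul_inv_le_one _) (le_of_eq ?_)).trans_eq (mul_one 1)
        rw [enorm_eq_nnnorm]
        simp
      simp_rw [act_mul, hF, act_mul]
      calc _ ≤ _ := hosc (act Vi (EuclideanSpace.single i (1 : ℂ)))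
        _ ≤ D * (apConst p U * R * (volume (cube a r) * ((C : ℝ≥0∞) ^ p * 1))) := by
          gcongr
          refine (hdoub _).trans ?_
          gcongr
          refine (hred _).trans ?_
          gcongr
        _ = _ := by ring
    calc _ ≤ (n : ℝ≥0∞) ^ (p - 1) *
          ∑ _i : Fin n, volume (cube a r) * (D * (apConst p U * R * (C : ℝ≥0∞) ^ p)) := by
          gcongr with i
          exact hcol i
      _ = _ := by
          rw [Finset.sum_const, Finset.card_univ, Fintype.card_fin, nsmul_eq_mul, hE]
          ring
  have hFtop : ∫⁻ x in cube a r, ‖matPow (W x) (1 / p) * F x‖ₑ ^ p ≠ ⊤ :=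
    ne_top_of_le_ne_top (ENNReal.mul_ne_top hvtop hEtop) hFE
  have hmean := lintegral_enorm_mul_average_le hp hW.toIsMatrixWeight a hr hFint hFtop
  have hmF : ⨍ t in cube a r, F t = ((⨍ y in cube a r, B y) - m) * Vi := by
    have h1 : ∫ t in cube a r, F t = (∫ t in cube a r, (B t - m)) * Vi :=
      integral_mul_const_of_integrable (hBJ.sub hcJ)
    have hreal : volume.real (cube a r) ≠ 0 := (ENNReal.toReal_pos hv0 hvtop).ne'
    rw [setAverage_eq, setAverage_eq, h1, integral_sub hBJ hcJ, setIntegral_const,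
      ← smul_mul_assoc, smul_sub, inv_smul_smul₀ hreal]
  -- Subtracting from `F` its own mean over `J` cancels `m`, the average over the translated cube.
  have hsplit : ∀ x, matPow (W x) (1 / p) * (B x - ⨍ y in cube a r, B y) * Vi =
      matPow (W x) (1 / p) * F x - matPow (W x) (1 / p) * ⨍ t in cube a r, F t := fun x => by
    rw [hmF, hF]
    noncomm_ring
  have hsum : ∫⁻ x in cube a r,
      ‖matPow (W x) (1 / p) * (B x - ⨍ y in cube a r, B y) * Vi‖ₑ ^ p ≤
        (2 : ℝ≥0∞) ^ (p - 1) * (volume (cube a r) * (E + apConst p W * E)) := by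
    calc _ ≤ ∫⁻ x in cube a r, (2 : ℝ≥0∞) ^ (p - 1) * (‖matPow (W x) (1 / p) * F x‖ₑ ^ p +
            ‖matPow (W x) (1 / p) * ⨍ t in cube a r, F t‖ₑ ^ p) := by
          refine lintegral_mono fun x => ?_
          dsimp only
          rw [hsplit]
          exact (ENNReal.rpow_le_rpow (enorm_sub_le) hp0.le).trans
            (ENNReal.rpow_add_le_mul_rpow_add_rpow _ _ hp.le)
      _ = (2 : ℝ≥0∞) ^ (p - 1) * ((∫⁻ x in cube a r, ‖matPow (W x) (1 / p) * F x‖ₑ ^ p) +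
            ∫⁻ x in cube a r, ‖matPow (W x) (1 / p) * ⨍ t in cube a r, F t‖ₑ ^ p) := by
          rw [lintegral_const_mul' _ _ (ENNReal.rpow_ne_top_of_nonneg (by linarith) (by simp)),
            lintegral_add_left' (hWF.enorm.pow_const p)]
      _ ≤ (2 : ℝ≥0∞) ^ (p - 1) * (volume (cube a r) * E + apConst p W * (volume (cube a r) * E)) := by
          gcongr
          exact hmean.trans (by gcongr)
      _ = _ := by ring
  rw [setLAverage_eq]
  refine ENNReal.div_le_of_le_mul (hsum.trans_eq ?_)
  ring

theorem IsDyadicGrid.subset_allCubes {𝒟 : Set (Set (Eu d))} (h : IsDyadicGrid 𝒟) :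
    𝒟 ⊆ allCubes d := fun I hI => by
  obtain ⟨a, k, rfl⟩ := h.isCube I hI
  exact ⟨a, _, by positivity, rfl⟩

end Main

end TwoWeight

theorem theorem3p3 (d n : ℕ) (p : ℝ) (hp : 1 < p)
    (U W : TwoWeight.Eu d → TwoWeight.Mat n)
    (hU : TwoWeight.IsMatrixAp p U) (hW : TwoWeight.IsMatrixAp p W)
    (B : TwoWeight.Eu d → TwoWeight.Mat n)
    (hB : ∀ i j, MeasureTheory.LocallyIntegrable (fun x => B x i j) MeasureTheory.volume) :
    (∀ K : TwoWeight.Eu d → ℂ, TwoWeight.IsHomogeneousKernel K →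
      TwoWeight.CommutatorBounded p K B U W →
        TwoWeight.TwoWeightBMO p W U (TwoWeight.allCubes d) B ∧
        ∀ 𝒟 : Set (Set (TwoWeight.Eu d)), TwoWeight.IsDyadicGrid 𝒟 →
          TwoWeight.TwoWeightBMO p W U 𝒟 B) ∧
    ∀ j : Fin d, TwoWeight.IsHomogeneousKernel (TwoWeight.rieszKernel j) :=
  ⟨fun _ hK hC =>
    have hB' := TwoWeight.locallyIntegrable_matrix hB
    ⟨TwoWeight.twoWeightBMO_of_commutatorBounded hp hU hW hB' hK hC subset_rfl,
      fun _ h𝒟 => TwoWeight.twoWeightBMO_of_commutatorBounded hp hU hW hB' hK hC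
        h𝒟.subset_allCubes⟩,
    TwoWeight.isHomogeneousKernel_rieszKernel⟩
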